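/- Let $k$ be a commutative domain; all maps below are $k$-linear and $\otimes=\otimes_k$. For $k$-algebras $A,B$, a *twisting map* is a map $s\colon B\otimes A\to A\otimes B$ such that $s(1\otimes a)=a\otimes 1$ and $s(b\otimes 1)=1\otimes b$ for all $a\in A$, $b\in B$, and $$s\circ(\mu_B\otimes A)=(A\otimes\mu_B)\circ(s\otimes B)\circ(B\otimes s),\qquad s\circ(B\otimes\mu_A)=(\mu_A\otimes B)\circ(A\otimes s)\circ(s\otimes A),$$ where $\mu_A,\mu_B$ are the multiplications and an algebra also denotes its identity map. Two twisting maps $s,t\colon B\otimes A\to A\otimes B$ are *equivalent* if there are algebra automorphisms $f$ of $A$ and $g$ of $B$ with $t\circ(g\otimes f)=(f\otimes g)\circ s$. Consider twisting maps $s\colon k[Y]\otimes k[X]\to k[X]\otimes k[Y]$. Write $s(Y\otimes a)=\sum_j\alpha_j(a)\otimes Y^j$, with $\alpha_j\colon k[X]\to k[X]$. Call $s$ *upper bounded* if there is $n_0\in\mathbb N$ with $\alpha_n=0$ for all $n\ge n_0$, and *lower bounded* if $\tau\circ s\circ\tau$ is upper bounded (with the roles of $X$ and $Y$ interchanged), where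 $\tau$ is the flip. Call $s$ *null* if $s(Y\otimes X)=\sum_{ij}q_{ij}X^i\otimes Y^j$ with $q_{ij}=0$ whenever $i\le 1$ or $j\le 1$, and *almost null* if it is equivalent to a null twisting map. Let $\sum_{ij}q'_{ij}X^i\otimes Y^j\in k[X]\otimes k[Y]$ and, for $i,j\ge 0$, put $$P_i(Z)=\sum_{n\ge0}q'_{in}Z^n,\qquad Q_j(Z)=\sum_{m\ge0}q'_{mj}Z^m.$$ For $\lambda,\xi\in k$ consider the conditions (a) $P_0(\xi)=0$, $P_1(\xi)=\xi$, $P_0'(\xi)=\lambda$, $P_1'(\xi)=0$, and $\xi$ is a multiple root of $P_i$ for each $i>1$; (b) $Q_0(\lambda)=0$, $Q_1(\lambda)=\lambda$, $Q_0'(\lambda)=\xi$, $Q_1'(\lambda)=0$, and $\lambda$ is a multiple root of $Q_j$ for each $j>1$. Here $c$ is a multiple root of $P$ if $(Z-c)^2$ divides $P$; in particular every $c\in k$ is a multiple root of the zero polynomial. Then: 1. There is an almost null twisting map $s'\colon k[Y]\otimes k[X]\to k[X]\otimes k[Y]$ with $s'(Y\otimes X)=\sum_{ij}q'_{ij}X^i\otimes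 Y^j$ if and only if there exist $\lambda,\xi\in k$ satisfying both (a) and (b). Moreover, whenever $\lambda,\xi$ satisfy (a) and (b) and $s'$ is a twisting map with $s'(Y\otimes X)=\sum_{ij}q'_{ij}X^i\otimes Y^j$, the automorphisms $f$ of $k[Y]$ and $g$ of $k[X]$ given by $f(Y)=Y-\xi$ and $g(X)=X-\lambda$ realize an equivalence of $s'$ with a null twisting map $s$, that is, $s'\circ(f\otimes g)=(g\otimes f)\circ s$. 2. If there exist $\lambda,\xi\in k$ that satisfy (a) but not (b), then there is no upper bounded twisting map $s'\colon k[Y]\otimes k[X]\to k[X]\otimes k[Y]$ with $s'(Y\otimes X)=\sum_{ij}q'_{ij}X^i\otimes Y^j$. 3. If there exist $\lambda,\xi\in k$ that satisfy (b) but not (a), then there is no lower bounded twisting map $s'\colon k[Y]\otimes k[X]\to k[X]\otimes k[Y]$ with $s'(Y\otimes X)=\sum_{ij}q'_{ij}X^i\otimes Y^j$. -/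

import Mathlib

open scoped TensorProduct Polynomial

noncomputable section

namespace TwistedPlane

section General

variable {k A B C D : Type*} [CommRing k] [Ring A] [Algebra k A] [Ring B] [Algebra k B]
  [Ring C] [Algebra k C] [Ring D] [Algebra k D]

/-- A `k`-linear map `s : B ⊗ A → A ⊗ B` is a twisting map if it is compatible with the units and
with the multiplications of `A` and `B`. -/
structure IsTwistingMap (s : B ⊗[k] A →ₗ[k] A ⊗[k] B) : Prop where
  one_tmul : ∀ a : A, s (1 ⊗ₜ[k] a) = a ⊗ₜ[k] 1
  tmul_one : ∀ b : B, s (b ⊗ₜ[k] 1) = 1 ⊗ₜ[k] b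
  /-- `s ∘ (μ_B ⊗ A) = (A ⊗ μ_B) ∘ (s ⊗ B) ∘ (B ⊗ s)` -/
  mul_left :
    s ∘ₗ (LinearMap.mul' k B).rTensor A =
      (LinearMap.mul' k B).lTensor A ∘ₗ (TensorProduct.assoc k A B B).toLinearMap ∘ₗ
        s.rTensor B ∘ₗ (TensorProduct.assoc k B A B).symm.toLinearMap ∘ₗ
        s.lTensor B ∘ₗ (TensorProduct.assoc k B B A).toLinearMap
  /-- `s ∘ (B ⊗ μ_A) = (μ_A ⊗ B) ∘ (A ⊗ s) ∘ (s ⊗ A)` -/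
  mul_right :
    s ∘ₗ (LinearMap.mul' k A).lTensor B =
      (LinearMap.mul' k A).rTensor B ∘ₗ (TensorProduct.assoc k A A B).symm.toLinearMap ∘ₗ
        s.lTensor A ∘ₗ (TensorProduct.assoc k A B A).toLinearMap ∘ₗ
        s.rTensor A ∘ₗ (TensorProduct.assoc k B A A).symm.toLinearMap

/-- The pair of algebra morphisms `f : A → C`, `g : B → D` is a morphism from the twisting map
`s : B ⊗ A → A ⊗ B` to the twisting map `t : D ⊗ C → C ⊗ D`, that is,
`t ∘ (g ⊗ f) = (f ⊗ g) ∘ s`. -/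
def IsTwistMorphism (f : A →ₐ[k] C) (g : B →ₐ[k] D)
    (s : B ⊗[k] A →ₗ[k] A ⊗[k] B) (t : D ⊗[k] C →ₗ[k] C ⊗[k] D) : Prop :=
  t ∘ₗ TensorProduct.map g.toLinearMap f.toLinearMap =
    TensorProduct.map f.toLinearMap g.toLinearMap ∘ₗ s

/-- Two maps `s, t : B ⊗ A → A ⊗ B` are equivalent if they are isomorphic through a pair of
algebra automorphisms of `A` and of `B`. -/
def TwistEquivalent (s t : B ⊗[k] A →ₗ[k] A ⊗[k] B) : Prop :=
  ∃ (f : A ≃ₐ[k] A) (g : B ≃ₐ[k] B), IsTwistMorphism (f : A →ₐ[k] A) (g : B →ₐ[k] B) s t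

/-- The map `τ ∘ s ∘ τ : A ⊗ B → B ⊗ A`, where `τ` denotes the flip. -/
def flipConj (s : B ⊗[k] A →ₗ[k] A ⊗[k] B) : A ⊗[k] B →ₗ[k] B ⊗[k] A :=
  (TensorProduct.comm k A B).toLinearMap ∘ₗ s ∘ₗ (TensorProduct.comm k A B).toLinearMap

/-- The maps `α_j : A → A` determined by `s (Y ⊗ a) = ∑ j, α_j a ⊗ Y ^ j`, for a linear map
`s : k[Y] ⊗ A → A ⊗ k[Y]`. -/
def alphaMap (s : k[X] ⊗[k] A →ₗ[k] A ⊗[k] k[X]) (j : ℕ) : A →ₗ[k] A :=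
  (TensorProduct.rid k A).toLinearMap ∘ₗ (Polynomial.lcoeff k j).lTensor A ∘ₗ s ∘ₗ
    TensorProduct.mk k k[X] A Polynomial.X

end General

variable {k : Type*} [CommRing k]

/-! In what follows a map `k[X] ⊗[k] k[X] →ₗ[k] k[X] ⊗[k] k[X]` stands for a map
`k[Y] ⊗ k[X] → k[X] ⊗ k[Y]`: in the source the first factor is `k[Y]`, in the target the second. -/

/-- `α_n = 0` for all large `n`. -/
def IsUpperBounded (s : k[X] ⊗[k] k[X] →ₗ[k] k[X] ⊗[k] k[X]) : Prop :=
  ∃ n₀ : ℕ, ∀ n ≥ n₀, alphaMap s n = 0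

/-- `τ ∘ s ∘ τ` is upper bounded. -/
def IsLowerBounded (s : k[X] ⊗[k] k[X] →ₗ[k] k[X] ⊗[k] k[X]) : Prop :=
  IsUpperBounded (flipConj s)

/-- The element `∑ q_{ij} X^i ⊗ Y^j` of `k[X] ⊗ k[Y]`. -/
def tensorOf (q : ℕ × ℕ →₀ k) : k[X] ⊗[k] k[X] :=
  ∑ p ∈ q.support, q p • ((Polynomial.X ^ p.1 : k[X]) ⊗ₜ[k] (Polynomial.X ^ p.2 : k[X]))

/-- The polynomial `P_i(Z) = ∑ n, q_{in} Z^n`. -/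
def rowPoly (q : ℕ × ℕ →₀ k) (i : ℕ) : k[X] :=
  ∑ p ∈ q.support with p.1 = i, Polynomial.monomial p.2 (q p)

/-- The polynomial `Q_j(Z) = ∑ m, q_{mj} Z^m`. -/
def colPoly (q : ℕ × ℕ →₀ k) (j : ℕ) : k[X] :=
  ∑ p ∈ q.support with p.2 = j, Polynomial.monomial p.1 (q p)

/-- `s` is a twisting map such that `s (Y ⊗ X) = ∑ q_{ij} X^i ⊗ Y^j` with `q_{ij} = 0` whenever
`i ≤ 1` or `j ≤ 1`. -/
def IsNullTwistingMap (s : k[X] ⊗[k] k[X] →ₗ[k] k[X] ⊗[k] k[X]) : Prop :=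
  IsTwistingMap s ∧ ∃ q : ℕ × ℕ →₀ k, (∀ i j : ℕ, i ≤ 1 ∨ j ≤ 1 → q (i, j) = 0) ∧
    s (Polynomial.X ⊗ₜ[k] Polynomial.X) = tensorOf q

/-- An almost null twisting map is a twisting map equivalent to one as in
`IsNullTwistingMap`. -/
def IsAlmostNull (s' : k[X] ⊗[k] k[X] →ₗ[k] k[X] ⊗[k] k[X]) : Prop :=
  IsTwistingMap s' ∧ ∃ s, IsNullTwistingMap s ∧ TwistEquivalent s s'

/-- `a` is a root of `p` of multiplicity at least two; by convention every `a` is a multiple root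
of the zero polynomial. -/
def IsMultipleRoot (p : k[X]) (a : k) : Prop :=
  (Polynomial.X - Polynomial.C a) ^ 2 ∣ p

/-- `P₀(ξ) = 0`, `P₁(ξ) = ξ`, `P₀'(ξ) = lam`, `P₁'(ξ) = 0`, and `ξ` is a multiple root of `P_i`
for each `i > 1`. -/
def CondA (q : ℕ × ℕ →₀ k) (lam ξ : k) : Prop :=
  (rowPoly q 0).eval ξ = 0 ∧ (rowPoly q 1).eval ξ = ξ ∧
    (rowPoly q 0).derivative.eval ξ = lam ∧ (rowPoly q 1).derivative.eval ξ = 0 ∧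
    ∀ i > 1, IsMultipleRoot (rowPoly q i) ξ

/-- `Q₀(lam) = 0`, `Q₁(lam) = lam`, `Q₀'(lam) = ξ`, `Q₁'(lam) = 0`, and `lam` is a multiple root of
`Q_j` for each `j > 1`. -/
def CondB (q : ℕ × ℕ →₀ k) (lam ξ : k) : Prop :=
  (colPoly q 0).eval lam = 0 ∧ (colPoly q 1).eval lam = lam ∧
    (colPoly q 0).derivative.eval lam = ξ ∧ (colPoly q 1).derivative.eval lam = 0 ∧
    ∀ j > 1, IsMultipleRoot (colPoly q j) lam

/-- The automorphism of the polynomial algebra that sends the variable to itself minus `a`. -/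
def shift (a : k) : k[X] ≃ₐ[k] k[X] :=
  Polynomial.algEquivAevalXAddC (-a)

theorem shift_X (a : k) : shift a Polynomial.X = Polynomial.X - Polynomial.C a := by
  simp [shift, sub_eq_add_neg]

end TwistedPlane

end

/-!
Write `C` for the algebra `k[X] ⊗ₛ k[Y]` given by a twisting map `s`, so that `Y X` stands for
`s (Y ⊗ X)`.

*The root conditions.* Read off coefficient by coefficient, (a) says that
`Y X - lam Y - ξ X + lam ξ` is divisible by `(Y - ξ) ^ 2` in the commutative algebra `k[X] ⊗ k[Y]`,
and (b) that it is divisible by `(X - lam) ^ 2` (`condA_iff_dvd`, `condB_iff_dvd`). That element is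
the product `(Y - ξ) (X - lam)` in `C`, so an affine change of variables moves `(lam, ξ)` to `(0, 0)`
(`IsTwistingMap.cond_iff`), where (a) and (b) together say that the twisting map is null. Automorphisms
of `k[X]` over a domain are affine, so almost null maps satisfy (a) and (b) for some `lam` and `ξ`.

*Existence.* If `q` is divisible by `X ^ 2` and by `Y ^ 2`, then `Y X = q` and `Y ^ i X ^ j = 0` for
all other positive `i` and `j` define a twisting map (`isTwistingMap_nullMap`): a second reordering
always meets `Y ^ i X ^ j` with `i ≥ 2` or `j ≥ 2`.

*Bounded maps.* It remains to see that for an upper bounded twisting map with `Y X` divisible by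
`Y ^ 2`, also `X ^ 2` divides `Y X` (`IsMulPair.C_X_sq_dvd_left_C_X`). All the elements `Y X ^ n` have
bounded degree in `Y`. Let `c Y ^ J` be the lowest term of `Y X` modulo the right ideal `X C`. Then
`J ≥ 2`, and modulo `X C` the lowest term of `Y X ^ n` is `c ^ n Y ^ (n (J - 1) + 1)`, so `c = 0`.
Hence `Y X = X d(Y)` modulo `X ^ 2 C`, with `d` divisible by `Y ^ 2`, and `Y X ^ m` is `X ^ m` times
the `m`-fold composite of `d` modulo `X ^ (m + 1) C`. If `d` were not zero, its degree would be at
least two, and those of the composites would not be bounded. The statement about lower bounded maps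
follows by flipping the factors.
-/

open scoped TensorProduct Polynomial

noncomputable section

namespace TwistedPlane

open Polynomial Algebra.TensorProduct

/-! ### Left multiplication by `Y` and right multiplication by `X` -/

/-- The part of the multiplication of a twisted tensor product `k[X] ⊗ₛ k[Y]` that the degree
arguments use. The underlying module is `k[X][Y]`, written `k[X][X]`: the outer variable is `Y`, and
`C X` is the inner variable. `L` is left multiplication by `Y`, which commutes with right
multiplication by `Y`, and `R` is right multiplication by `X`, which is `k[X]`-linear on the left.
The last two fields say `Y ^ (i + 1) X = Y (Y ^ i X)` and `Y X ^ (n + 1) = (Y X ^ n) X`. -/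
structure IsMulPair {k : Type*} [CommRing k] (L R : k[X][X] →ₗ[k] k[X][X]) : Prop where
  left_X_mul : ∀ w, L (X * w) = X * L w
  right_C_mul : ∀ a w, R (C a * w) = C a * R w
  left_one : L 1 = X
  right_one : R 1 = C X
  right_X_pow_succ : ∀ i, R (X ^ (i + 1)) = L (R (X ^ i))
  left_C_X_pow_succ : ∀ n, L (C (X ^ (n + 1))) = R (L (C (X ^ n)))

/-- The substitution `X = 0` in `k[X][Y]`. -/
def evalInner (k : Type*) [CommRing k] : k[X][X] →+* k[X] :=
  mapRingHom (evalRingHom 0)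

/-- The inclusion of `k[Y]` in `k[X][Y]`. -/
def inclOuter (k : Type*) [CommRing k] : k[X] →+* k[X][X] :=
  mapRingHom C

section EvalInner

variable {k : Type*} [CommRing k]

@[simp] lemma evalInner_X : evalInner k X = X := by simp [evalInner]

@[simp] lemma evalInner_C (a : k[X]) : evalInner k (C a) = C (a.eval 0) := by simp [evalInner]

@[simp] lemma inclOuter_X : inclOuter k X = X := by simp [inclOuter]

@[simp] lemma inclOuter_C (a : k) : inclOuter k (C a) = C (C a) := by simp [inclOuter]

lemma coeff_evalInner (w : k[X][X]) (n : ℕ) : (evalInner k w).coeff n = (w.coeff n).eval 0 := by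
  simp [evalInner]

@[simp] lemma evalInner_inclOuter (p : k[X]) : evalInner k (inclOuter k p) = p := by
  ext n
  simp [coeff_evalInner, inclOuter]

lemma C_X_dvd_iff {w : k[X][X]} : C X ∣ w ↔ evalInner k w = 0 := by
  rw [C_dvd_iff_dvd_coeff]
  simp only [X_dvd_iff, Polynomial.ext_iff, coeff_evalInner, coeff_zero, coeff_zero_eq_eval_zero]

lemma exists_eq_inclOuter_add (w : k[X][X]) :
    ∃ v, w = inclOuter k (evalInner k w) + C X * v := by
  have h : C X ∣ w - inclOuter k (evalInner k w) := by
    rw [C_X_dvd_iff]; simp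
  obtain ⟨v, hv⟩ := h
  exact ⟨v, by rw [← hv]; ring⟩

end EvalInner

namespace IsMulPair

section Ring

variable {k : Type*} [CommRing k] {L R : k[X][X] →ₗ[k] k[X][X]}

lemma left_X_pow_mul (h : IsMulPair L R) (m : ℕ) (w : k[X][X]) :
    L (X ^ m * w) = X ^ m * L w := by
  induction m with
  | zero => simp
  | succ m ih => rw [pow_succ', mul_assoc, h.left_X_mul, ih, mul_assoc]

lemma left_inclOuter_mul (h : IsMulPair L R) (p : k[X]) (w : k[X][X]) :
    L (inclOuter k p * w) = inclOuter k p * L w := by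
  induction p using Polynomial.induction_on' with
  | add p q hp hq => simp [add_mul, hp, hq]
  | monomial n a =>
    rw [← C_mul_X_pow_eq_monomial, map_mul (inclOuter k), map_pow, inclOuter_X, inclOuter_C,
      mul_assoc, mul_assoc, show (C (C a) : k[X][X]) = algebraMap k k[X][X] a from rfl,
      ← Algebra.smul_def, map_smul, h.left_X_pow_mul, Algebra.smul_def]

lemma left_inclOuter (h : IsMulPair L R) (p : k[X]) :
    L (inclOuter k p) = inclOuter k p * X := by
  simpa [h.left_one] using h.left_inclOuter_mul p 1

/-- The values of `L` at `X ^ n Y ^ j` lie in an ideal as soon as those at `X ^ n` do. The ideal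
membership is asked only for exponents `n ≥ m`, and obtained on the multiples of `X ^ m`. -/
lemma left_mem (h : IsMulPair L R) {I : Ideal k[X][X]} {m : ℕ}
    (hI : ∀ n, L (C (X ^ (m + n))) ∈ I) (w : k[X][X]) : L (C (X ^ m) * w) ∈ I := by
  have aux : ∀ a : k[X], L (C (X ^ m) * C a) ∈ I := by
    intro a
    induction a using Polynomial.induction_on' with
    | add p q hp hq => rw [C_add, mul_add, map_add]; exact I.add_mem hp hq
    | monomial n a =>
      rw [← C_mul_X_pow_eq_monomial, ← C_mul, mul_left_comm, ← pow_add, C_mul,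
        show (C (C a) : k[X][X]) = algebraMap k k[X][X] a from rfl, ← Algebra.smul_def, map_smul,
        Algebra.smul_def]
      exact I.mul_mem_left _ (hI n)
  induction w using Polynomial.induction_on' with
  | add p q hp hq => rw [mul_add, map_add]; exact I.add_mem hp hq
  | monomial n a =>
    rw [← C_mul_X_pow_eq_monomial, ← mul_assoc, mul_comm, h.left_X_pow_mul]
    exact I.mul_mem_left _ (aux a)

lemma right_mem (h : IsMulPair L R) {I : Ideal k[X][X]} {m : ℕ}
    (hI : ∀ i, R (X ^ (m + i)) ∈ I) (w : k[X][X]) : R (X ^ m * w) ∈ I := by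
  induction w using Polynomial.induction_on' with
  | add p q hp hq => rw [mul_add, map_add]; exact I.add_mem hp hq
  | monomial n a =>
    rw [← C_mul_X_pow_eq_monomial, mul_left_comm, ← pow_add, h.right_C_mul]
    exact I.mul_mem_left _ (hI n)

lemma right_X (h : IsMulPair L R) : R X = L (C X) := by
  simpa [h.right_one] using h.right_X_pow_succ 0

lemma X_dvd_right_X_pow_succ (h : IsMulPair L R) (hq : X ^ 2 ∣ L (C X)) (i : ℕ) :
    X ∣ R (X ^ (i + 1)) := by
  induction i with
  | zero => simpa [h.right_X] using (dvd_pow_self X two_ne_zero).trans hq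
  | succ i ih =>
    obtain ⟨v, hv⟩ := ih
    rw [h.right_X_pow_succ, hv, h.left_X_mul]
    exact dvd_mul_right _ _

lemma X_dvd_left (h : IsMulPair L R) (hq : X ^ 2 ∣ L (C X)) (w : k[X][X]) : X ∣ L w := by
  have key : ∀ n, X ∣ L (C (X ^ n)) := by
    intro n
    induction n with
    | zero => simp [h.left_one]
    | succ n ih =>
      obtain ⟨v, hv⟩ := ih
      rw [h.left_C_X_pow_succ, hv, ← Ideal.mem_span_singleton, ← pow_one (X : k[X][X])]
      refine h.right_mem (fun i => ?_) v
      rw [Ideal.mem_span_singleton, add_comm, pow_one]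
      exact h.X_dvd_right_X_pow_succ hq i
  have := h.left_mem (I := Ideal.span {X}) (m := 0)
    (fun n => by simpa [Ideal.mem_span_singleton] using key n) w
  simpa [Ideal.mem_span_singleton] using this

lemma X_pow_succ_dvd_left (h : IsMulPair L R) (hq : X ^ 2 ∣ L (C X)) {m : ℕ} {w : k[X][X]}
    (hw : X ^ m ∣ w) : X ^ (m + 1) ∣ L w := by
  obtain ⟨v, rfl⟩ := hw
  rw [h.left_X_pow_mul, pow_succ]
  exact mul_dvd_mul_left _ (h.X_dvd_left hq v)

lemma X_pow_dvd_right_X_pow (h : IsMulPair L R) (hq : X ^ 2 ∣ L (C X)) (i : ℕ) :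
    X ^ (i + 2) ∣ R (X ^ (i + 1)) := by
  induction i with
  | zero => simpa [h.right_X] using hq
  | succ i ih =>
    rw [h.right_X_pow_succ]
    exact h.X_pow_succ_dvd_left hq ih

lemma X_pow_dvd_right (h : IsMulPair L R) (hq : X ^ 2 ∣ L (C X)) {i : ℕ} {w : k[X][X]}
    (hw : X ^ (i + 1) ∣ w) : X ^ (i + 2) ∣ R w := by
  obtain ⟨v, rfl⟩ := hw
  rw [← Ideal.mem_span_singleton]
  refine h.right_mem (fun j => ?_) v
  rw [Ideal.mem_span_singleton, show i + 1 + j = (i + j) + 1 by ring]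
  exact (pow_dvd_pow _ (by omega)).trans (h.X_pow_dvd_right_X_pow hq (i + j))

/-- Right multiplication by `X` preserves the right ideal generated by `X`, so modulo that ideal it
depends only on the value at `X = 0`. -/
lemma evalInner_right (h : IsMulPair L R) (w : k[X][X]) :
    evalInner k (R w) = evalInner k (R (inclOuter k (evalInner k w))) := by
  obtain ⟨v, hv⟩ := exists_eq_inclOuter_add w
  conv_lhs => rw [hv, map_add, h.right_C_mul]
  simp

/-! ### The terms of degree zero in `X` -/

lemma X_pow_dvd_evalInner_left (h : IsMulPair L R) (hq : X ^ 2 ∣ L (C X)) {J : ℕ}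
    (hJ : X ^ (J + 1) ∣ evalInner k (L (C X))) (w : k[X][X]) :
    X ^ (J + 1) ∣ evalInner k (L (C X * w)) := by
  have key : ∀ n, X ^ (J + 1) ∣ evalInner k (L (C (X ^ (1 + n)))) := by
    intro n
    induction n with
    | zero => simpa using hJ
    | succ n ih =>
      rw [← add_assoc, h.left_C_X_pow_succ, h.evalInner_right]
      have := map_dvd (inclOuter k) ih
      rw [map_pow, inclOuter_X] at this
      have := map_dvd (evalInner k) (h.X_pow_dvd_right hq this)
      rw [map_pow, evalInner_X] at this
      exact (pow_dvd_pow _ (by omega)).trans this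
  have := h.left_mem (I := (Ideal.span {X ^ (J + 1)}).comap (evalInner k)) (m := 1)
    (fun n => by simpa only [Ideal.mem_comap, Ideal.mem_span_singleton] using key n) w
  simpa only [Ideal.mem_comap, Ideal.mem_span_singleton, pow_one] using this

/-- `Y ^ (i + 1) X` agrees with `q Y ^ i` modulo `X` and up to terms of higher order in `Y`, where
`q = Y X`. -/
lemma X_pow_dvd_evalInner_right_sub (h : IsMulPair L R) (hq : X ^ 2 ∣ L (C X)) {J : ℕ}
    (hJ : X ^ (J + 1) ∣ evalInner k (L (C X))) (i : ℕ) :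
    X ^ (J + 1 + i + 1) ∣
      evalInner k (R (X ^ (i + 1))) - X ^ i * evalInner k (L (C X)) := by
  induction i with
  | zero => simp [h.right_X]
  | succ i ih =>
    obtain ⟨v, hv⟩ := h.X_pow_dvd_right_X_pow hq i
    obtain ⟨v₁, hv₁⟩ := exists_eq_inclOuter_add v
    have e : evalInner k (R (X ^ (i + 1 + 1))) =
        X * evalInner k (R (X ^ (i + 1))) + X ^ (i + 2) * evalInner k (L (C X * v₁)) := by
      rw [h.right_X_pow_succ, hv, h.left_X_pow_mul]
      conv_lhs => rw [hv₁, map_add, h.left_inclOuter]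
      simp only [map_mul, map_add, map_pow, evalInner_X, evalInner_inclOuter]
      ring
    rw [e, show X * evalInner k (R (X ^ (i + 1))) + X ^ (i + 2) * evalInner k (L (C X * v₁)) -
        X ^ (i + 1) * evalInner k (L (C X)) =
        X * (evalInner k (R (X ^ (i + 1))) - X ^ i * evalInner k (L (C X))) +
          X ^ (i + 2) * evalInner k (L (C X * v₁)) by ring]
    refine dvd_add ?_ ?_
    · rw [show J + 1 + (i + 1) + 1 = (J + 1 + i + 1) + 1 by ring, pow_succ']
      exact mul_dvd_mul_left _ ih
    · rw [show J + 1 + (i + 1) + 1 = (i + 2) + (J + 1) by ring, pow_add]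
      exact mul_dvd_mul_left _ (h.X_pow_dvd_evalInner_left hq hJ v₁)

lemma X_pow_dvd_evalInner_right_X_pow (h : IsMulPair L R) (hq : X ^ 2 ∣ L (C X)) {J : ℕ}
    (hJ : X ^ (J + 1) ∣ evalInner k (L (C X))) (i : ℕ) :
    X ^ (J + 1 + i) ∣ evalInner k (R (X ^ (i + 1))) := by
  have h1 := (pow_dvd_pow X (Nat.le_succ _)).trans (h.X_pow_dvd_evalInner_right_sub hq hJ i)
  rw [dvd_sub_left] at h1
  · exact h1
  · rw [add_comm, pow_add]
    exact mul_dvd_mul_left _ hJ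

lemma X_pow_dvd_evalInner_right (h : IsMulPair L R) (hq : X ^ 2 ∣ L (C X)) {J : ℕ}
    (hJ : X ^ (J + 1) ∣ evalInner k (L (C X))) {i : ℕ} {w : k[X][X]} (hw : X ^ (i + 1) ∣ w) :
    X ^ (J + 1 + i) ∣ evalInner k (R w) := by
  obtain ⟨v, rfl⟩ := hw
  have := h.right_mem (I := (Ideal.span {X ^ (J + 1 + i)}).comap (evalInner k)) (m := i + 1)
    (fun n => by
      rw [Ideal.mem_comap, Ideal.mem_span_singleton, show i + 1 + n = (i + n) + 1 by ring]
      exact (pow_dvd_pow _ (by omega)).trans (h.X_pow_dvd_evalInner_right_X_pow hq hJ (i + n))) v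
  simpa only [Ideal.mem_comap, Ideal.mem_span_singleton] using this

lemma coeff_evalInner_right_X_pow (h : IsMulPair L R) (hq : X ^ 2 ∣ L (C X)) {J : ℕ}
    (hJ : X ^ (J + 1) ∣ evalInner k (L (C X))) (i : ℕ) :
    (evalInner k (R (X ^ (i + 1)))).coeff (J + 1 + i) = (evalInner k (L (C X))).coeff (J + 1) := by
  have h1 := X_pow_dvd_iff.1 (h.X_pow_dvd_evalInner_right_sub hq hJ i) (J + 1 + i)
    (Nat.lt_succ_self _)
  rwa [coeff_sub, sub_eq_zero, coeff_X_pow_mul] at h1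

/-- The lowest term in `Y` of `Y X ^ n` modulo the right ideal generated by `X`. -/
lemma evalInner_left_X_pow (h : IsMulPair L R) (hq : X ^ 2 ∣ L (C X)) {J : ℕ}
    (hJ : X ^ (J + 1) ∣ evalInner k (L (C X))) (n : ℕ) :
    X ^ (n * J + 1) ∣ evalInner k (L (C (X ^ n))) ∧
      (evalInner k (L (C (X ^ n)))).coeff (n * J + 1) =
        (evalInner k (L (C X))).coeff (J + 1) ^ n := by
  induction n with
  | zero => simp [h.left_one]
  | succ n ih =>
    obtain ⟨⟨p, hp⟩, hc⟩ := ih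
    have hp0 : p.coeff 0 = (evalInner k (L (C X))).coeff (J + 1) ^ n := by
      rw [← hc, hp]
      simpa using (coeff_X_pow_mul p (n * J + 1) 0).symm
    have hdec : inclOuter k (X ^ (n * J + 1) * p) =
        C (C (p.coeff 0)) * X ^ (n * J + 1) + X ^ (n * J + 1 + 1) * inclOuter k p.divX := by
      conv_lhs => rw [← divX_mul_X_add p]
      simp only [map_mul, map_add, map_pow, inclOuter_X, inclOuter_C]
      ring
    have e : evalInner k (L (C (X ^ (n + 1)))) =
        C (p.coeff 0) * evalInner k (R (X ^ (n * J + 1))) +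
          evalInner k (R (X ^ (n * J + 1 + 1) * inclOuter k p.divX)) := by
      rw [h.left_C_X_pow_succ, h.evalInner_right, hp, hdec, map_add, h.right_C_mul]
      simp
    have h1 := h.X_pow_dvd_evalInner_right_X_pow hq hJ (n * J)
    have h2 : X ^ (J + 1 + (n * J + 1)) ∣
        evalInner k (R (X ^ (n * J + 1 + 1) * inclOuter k p.divX)) :=
      h.X_pow_dvd_evalInner_right hq hJ (dvd_mul_right _ _)
    have h3 := X_pow_dvd_iff.1 h2 (J + 1 + n * J) (by omega)
    rw [e, show (n + 1) * J + 1 = J + 1 + n * J by ring]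
    refine ⟨dvd_add (h1.mul_left _) ((pow_dvd_pow _ (by omega)).trans h2), ?_⟩
    rw [coeff_add, h3, add_zero, coeff_C_mul, h.coeff_evalInner_right_X_pow hq hJ, hp0, pow_succ]

/-! ### The terms of degree one in `X` -/

section DegreeOne

variable {q₁ : k[X][X]}

lemma C_X_dvd_right (h : IsMulPair L R) (hq₁ : L (C X) = C X * q₁) (w : k[X][X]) :
    C X ∣ R w := by
  have h1 : ∀ n, C X ∣ L (C (X ^ (1 + n))) := by
    intro n
    induction n with
    | zero => simp [hq₁]
    | succ n ih =>
      obtain ⟨v, hv⟩ := ih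
      rw [← add_assoc, h.left_C_X_pow_succ, hv, h.right_C_mul]
      exact dvd_mul_right _ _
  have h2 : ∀ i, C X ∣ R (X ^ i) := by
    intro i
    induction i with
    | zero => simp [h.right_one]
    | succ i ih =>
      obtain ⟨v, hv⟩ := ih
      have := h.left_mem (I := Ideal.span {C X}) (m := 1)
        (fun n => Ideal.mem_span_singleton.2 (h1 n)) v
      rwa [Ideal.mem_span_singleton, pow_one, ← hv, ← h.right_X_pow_succ] at this
  have := h.right_mem (I := Ideal.span {C X}) (m := 0)
    (fun n => by simpa [Ideal.mem_span_singleton] using h2 n) w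
  simpa [Ideal.mem_span_singleton] using this

lemma C_X_sq_dvd_left (h : IsMulPair L R) (hq₁ : L (C X) = C X * q₁) (w : k[X][X]) :
    C (X ^ 2) ∣ L (C (X ^ 2) * w) := by
  have h1 : ∀ n, C (X ^ 2) ∣ L (C (X ^ (2 + n))) := by
    intro n
    induction n with
    | zero =>
      obtain ⟨v, hv⟩ := h.C_X_dvd_right hq₁ q₁
      rw [add_zero, h.left_C_X_pow_succ, pow_one, hq₁, h.right_C_mul, hv, C_pow]
      exact ⟨v, by ring⟩
    | succ n ih =>
      obtain ⟨v, hv⟩ := ih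
      rw [← add_assoc, h.left_C_X_pow_succ, hv, h.right_C_mul]
      exact dvd_mul_right _ _
  simpa only [Ideal.mem_span_singleton] using h.left_mem (I := Ideal.span {C (X ^ 2)}) (m := 2)
    (fun n => Ideal.mem_span_singleton.2 (h1 n)) w

/-- If `Y X = X q₁` and `d = q₁(0, Y)`, then `p(Y) X = X p(d)` modulo `X ^ 2`. -/
lemma exists_right_inclOuter_eq (h : IsMulPair L R) (hq₁ : L (C X) = C X * q₁) (p : k[X]) :
    ∃ v, R (inclOuter k p) = C X * v ∧ evalInner k v = p.comp (evalInner k q₁) := by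
  have key : ∀ i, ∃ v, R (X ^ i) = C X * v ∧ evalInner k v = evalInner k q₁ ^ i := by
    intro i
    induction i with
    | zero => exact ⟨1, by simp [h.right_one]⟩
    | succ i ih =>
      obtain ⟨v, hv, hv'⟩ := ih
      obtain ⟨v₁, hv₁⟩ := exists_eq_inclOuter_add v
      obtain ⟨u, hu⟩ := h.C_X_sq_dvd_left hq₁ v₁
      refine ⟨inclOuter k (evalInner k v) * q₁ + C X * u, ?_, ?_⟩
      · rw [h.right_X_pow_succ, hv]
        conv_lhs => rw [hv₁]
        rw [mul_add, map_add, mul_comm, h.left_inclOuter_mul, hq₁, ← mul_assoc (C X) (C X) v₁, ← sq,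
          ← C_pow, hu, C_pow]
        ring
      · simp [hv', pow_succ]
  induction p using Polynomial.induction_on' with
  | add p q hp hq =>
    obtain ⟨v, hv, hv'⟩ := hp
    obtain ⟨u, hu, hu'⟩ := hq
    exact ⟨v + u, by simp [hv, hu, mul_add], by simp [hv', hu']⟩
  | monomial n a =>
    obtain ⟨v, hv, hv'⟩ := key n
    refine ⟨C (C a) * v, ?_, ?_⟩
    · rw [← C_mul_X_pow_eq_monomial, map_mul, map_pow, inclOuter_X, inclOuter_C, h.right_C_mul, hv]
      ring
    · simp [hv', ← C_mul_X_pow_eq_monomial]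

/-- If `Y X = X q₁` and `d = q₁(0, Y)`, then `Y X ^ m` is `X ^ m` times the `m`-fold composite of
`d`, modulo `X ^ (m + 1)`. -/
lemma exists_left_C_X_pow_eq (h : IsMulPair L R) (hq₁ : L (C X) = C X * q₁) (m : ℕ) :
    ∃ v, L (C (X ^ m)) = C (X ^ m) * v ∧
      evalInner k v = (fun p => p.comp (evalInner k q₁))^[m] X := by
  induction m with
  | zero => exact ⟨X, by simp [h.left_one]⟩
  | succ m ih =>
    obtain ⟨v, hv, hv'⟩ := ih
    obtain ⟨v₁, hv₁⟩ := exists_eq_inclOuter_add v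
    obtain ⟨u, hu, hu'⟩ := h.exists_right_inclOuter_eq hq₁ (evalInner k v)
    obtain ⟨t, ht⟩ := h.C_X_dvd_right hq₁ v₁
    refine ⟨u + C X * t, ?_, ?_⟩
    · rw [h.left_C_X_pow_succ, hv, h.right_C_mul]
      conv_lhs => rw [hv₁]
      rw [map_add, h.right_C_mul, hu, ht, pow_succ, C_mul]
      ring
    · simp [hu', hv', Function.iterate_succ_apply']

end DegreeOne

end Ring

section Domain

variable {k : Type*} [CommRing k] [IsDomain k] {L R : k[X][X] →ₗ[k] k[X][X]}

lemma C_X_dvd_left_C_X (h : IsMulPair L R) (hq : X ^ 2 ∣ L (C X)) {N : ℕ}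
    (hN : ∀ a, (L (C a)).natDegree ≤ N) : C X ∣ L (C X) := by
  have key : ∀ J, X ^ (J + 1 + 1) ∣ evalInner k (L (C X)) := by
    intro J
    induction J with
    | zero => simpa using map_dvd (evalInner k) hq
    | succ J ih =>
      -- `Y X ^ n` would have the nonzero coefficient `c ^ n` in degree `n (J + 1) + 1 > n`.
      have hc := (h.evalInner_left_X_pow hq ih N).2
      rw [coeff_evalInner, coeff_eq_zero_of_natDegree_lt, eval_zero] at hc
      · have hc' := eq_zero_of_pow_eq_zero hc.symm
        rw [X_pow_dvd_iff] at ih ⊢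
        intro d hd
        rcases Nat.lt_succ_iff_lt_or_eq.1 hd with hd | rfl
        · exact ih d hd
        · exact hc'
      · exact (hN _).trans_lt (by nlinarith [Nat.zero_le (N * J)])
  rw [C_X_dvd_iff]
  ext n
  simpa using X_pow_dvd_iff.1 (key n) n (by omega)

/-- If `Y X` is divisible by `Y ^ 2` and the degrees in `Y` of the elements `Y a` with `a` in `k[X]`
are bounded, then `Y X` is divisible by `X ^ 2`. -/
theorem C_X_sq_dvd_left_C_X (h : IsMulPair L R) (hq : X ^ 2 ∣ L (C X)) {N : ℕ}
    (hN : ∀ a, (L (C a)).natDegree ≤ N) : C (X ^ 2) ∣ L (C X) := by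
  obtain ⟨q₁, hq₁⟩ := h.C_X_dvd_left_C_X hq hN
  have hX : (C X : k[X][X]) ≠ 0 := by simp
  suffices evalInner k q₁ = 0 by
    obtain ⟨v, hv⟩ := C_X_dvd_iff.2 this
    exact ⟨v, by rw [hq₁, hv, C_pow]; ring⟩
  by_contra hd
  have hdvd : X ^ 2 ∣ q₁ := by
    rw [hq₁, X_pow_dvd_iff] at hq
    rw [X_pow_dvd_iff]
    intro d hd
    simpa using hq d hd
  have hdeg : 2 ≤ (evalInner k q₁).natDegree := by
    have h1 := map_dvd (evalInner k) hdvd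
    simpa using natDegree_le_of_dvd h1 hd
  -- `Y X ^ m` would have degree at least `2 ^ m` in `Y`.
  obtain ⟨v, hv, hv'⟩ := h.exists_left_C_X_pow_eq hq₁ N
  have h1 : v.natDegree ≤ N := by
    have := hN (X ^ N)
    rwa [hv, natDegree_C_mul (by simp)] at this
  have h2 : (evalInner k v).natDegree ≤ N := natDegree_map_le.trans h1
  have h3 : ∀ m, ((fun p : k[X] => p.comp (evalInner k q₁))^[m] X).natDegree =
      (evalInner k q₁).natDegree ^ m := by
    intro m
    induction m with
    | zero => simp
    | succ m ih => rw [Function.iterate_succ_apply', natDegree_comp, ih, pow_succ]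
  rw [hv', h3] at h2
  exact absurd (Nat.lt_two_pow_self.trans_le (Nat.pow_le_pow_left hdeg N)) (not_lt.2 h2)

end Domain

end IsMulPair

/-! ### Twisting maps of commutative algebras -/

section Commutative

variable {k A B : Type*} [CommRing k] [CommRing A] [Algebra k A] [CommRing B] [Algebra k B]

/-- Left multiplication by `b` in the twisted tensor product `A ⊗ₛ B`, that is,
`u ⊗ v ↦ s (b ⊗ u) (1 ⊗ v)`. The product on the right is that of the ordinary tensor product. -/
def leftMul (s : B ⊗[k] A →ₗ[k] A ⊗[k] B) (b : B) : A ⊗[k] B →ₗ[k] A ⊗[k] B :=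
  TensorProduct.lift ((LinearMap.mul k (A ⊗[k] B)).compl₁₂ (s ∘ₗ TensorProduct.mk k B A b)
    (includeRight : B →ₐ[k] A ⊗[k] B).toLinearMap)

/-- Right multiplication by `a` in the twisted tensor product `A ⊗ₛ B`, that is,
`u ⊗ v ↦ (u ⊗ 1) s (v ⊗ a)`. The product on the right is that of the ordinary tensor product. -/
def rightMul (s : B ⊗[k] A →ₗ[k] A ⊗[k] B) (a : A) : A ⊗[k] B →ₗ[k] A ⊗[k] B :=
  TensorProduct.lift ((LinearMap.mul k (A ⊗[k] B)).compl₁₂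
    (includeLeft : A →ₐ[k] A ⊗[k] B).toLinearMap (s ∘ₗ (TensorProduct.mk k B A).flip a))

variable {s : B ⊗[k] A →ₗ[k] A ⊗[k] B}

@[simp] lemma leftMul_tmul (b : B) (u : A) (v : B) :
    leftMul s b (u ⊗ₜ v) = s (b ⊗ₜ u) * (1 ⊗ₜ v) := rfl

@[simp] lemma rightMul_tmul (a : A) (u : A) (v : B) :
    rightMul s a (u ⊗ₜ v) = (u ⊗ₜ 1) * s (v ⊗ₜ a) := rfl

lemma leftMul_mul_tmul (b : B) (T : A ⊗[k] B) (v : B) :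
    leftMul s b (T * (1 ⊗ₜ v)) = leftMul s b T * (1 ⊗ₜ v) := by
  induction T using TensorProduct.induction_on with
  | zero => simp
  | add x y hx hy => rw [add_mul, map_add, hx, hy, map_add, add_mul]
  | tmul x y => simp [mul_assoc]

lemma rightMul_tmul_mul (a : A) (u : A) (T : A ⊗[k] B) :
    rightMul s a ((u ⊗ₜ 1) * T) = (u ⊗ₜ 1) * rightMul s a T := by
  induction T using TensorProduct.induction_on with
  | zero => simp
  | add x y hx hy => rw [mul_add, map_add, hx, hy, map_add, mul_add]
  | tmul x y =>
    rw [tmul_mul_tmul, one_mul, rightMul_tmul, rightMul_tmul, ← mul_assoc, tmul_mul_tmul, one_mul]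

variable (s) in
lemma leftMul_eq (b : B) (T : A ⊗[k] B) :
    (LinearMap.mul' k B).lTensor A (TensorProduct.assoc k A B B
      (s.rTensor B ((TensorProduct.assoc k B A B).symm (b ⊗ₜ T)))) = leftMul s b T := by
  induction T using TensorProduct.induction_on with
  | zero => simp
  | add x y hx hy => rw [TensorProduct.tmul_add]; simp only [map_add, hx, hy]
  | tmul u v =>
    rw [TensorProduct.assoc_symm_tmul, LinearMap.rTensor_tmul, leftMul_tmul]
    induction s (b ⊗ₜ u) using TensorProduct.induction_on with
    | zero => simp
    | add x y hx hy => rw [TensorProduct.add_tmul]; simp only [map_add, hx, hy, add_mul]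
    | tmul x y => simp

variable (s) in
lemma rightMul_eq (a : A) (T : A ⊗[k] B) :
    (LinearMap.mul' k A).rTensor B ((TensorProduct.assoc k A A B).symm
      (s.lTensor A (TensorProduct.assoc k A B A (T ⊗ₜ a)))) = rightMul s a T := by
  induction T using TensorProduct.induction_on with
  | zero => simp
  | add x y hx hy => rw [TensorProduct.add_tmul]; simp only [map_add, hx, hy]
  | tmul u v =>
    rw [TensorProduct.assoc_tmul, LinearMap.lTensor_tmul, rightMul_tmul]
    induction s (v ⊗ₜ a) using TensorProduct.induction_on with
    | zero => simp
    | add x y hx hy => rw [TensorProduct.tmul_add]; simp only [map_add, hx, hy, mul_add]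
    | tmul x y => simp

lemma isTwistingMap_iff :
    IsTwistingMap s ↔ (∀ a : A, s (1 ⊗ₜ a) = a ⊗ₜ 1) ∧ (∀ b : B, s (b ⊗ₜ 1) = 1 ⊗ₜ b) ∧
      (∀ b b' a, s ((b * b') ⊗ₜ a) = leftMul s b (s (b' ⊗ₜ a))) ∧
      ∀ b a a', s (b ⊗ₜ (a * a')) = rightMul s a' (s (b ⊗ₜ a)) := by
  constructor
  · rintro ⟨h1, h2, h3, h4⟩
    refine ⟨h1, h2, fun b b' a => ?_, fun b a a' => ?_⟩
    · have := LinearMap.congr_fun h3 ((b ⊗ₜ b') ⊗ₜ a)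
      simpa [leftMul_eq] using this
    · have := LinearMap.congr_fun h4 (b ⊗ₜ (a ⊗ₜ a'))
      simpa [rightMul_eq] using this
  · rintro ⟨h1, h2, h3, h4⟩
    refine ⟨h1, h2, TensorProduct.ext_threefold fun b b' a => ?_, ?_⟩
    · simpa [leftMul_eq] using h3 b b' a
    · refine TensorProduct.ext' fun b T => ?_
      induction T using TensorProduct.induction_on with
      | zero => simp
      | add x y hx hy => rw [TensorProduct.tmul_add, map_add, hx, hy, map_add]
      | tmul a a' => simpa [rightMul_eq] using h4 b a a'

lemma IsTwistingMap.map_mul_tmul (h : IsTwistingMap s) (b b' : B) (a : A) :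
    s ((b * b') ⊗ₜ a) = leftMul s b (s (b' ⊗ₜ a)) :=
  (isTwistingMap_iff.1 h).2.2.1 b b' a

lemma IsTwistingMap.map_tmul_mul (h : IsTwistingMap s) (b : B) (a a' : A) :
    s (b ⊗ₜ (a * a')) = rightMul s a' (s (b ⊗ₜ a)) :=
  (isTwistingMap_iff.1 h).2.2.2 b a a'

lemma flipConj_tmul (a : A) (b : B) :
    flipConj s (a ⊗ₜ b) = Algebra.TensorProduct.comm k A B (s (b ⊗ₜ a)) := rfl

lemma leftMul_flipConj (a : A) (T : A ⊗[k] B) :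
    leftMul (flipConj s) a (Algebra.TensorProduct.comm k A B T) =
      Algebra.TensorProduct.comm k A B (rightMul s a T) := by
  induction T using TensorProduct.induction_on with
  | zero => simp
  | add x y hx hy => simp only [map_add, hx, hy]
  | tmul u v =>
    rw [comm_tmul, leftMul_tmul, flipConj_tmul, rightMul_tmul, map_mul, comm_tmul, mul_comm]

lemma rightMul_flipConj (b : B) (T : A ⊗[k] B) :
    rightMul (flipConj s) b (Algebra.TensorProduct.comm k A B T) =
      Algebra.TensorProduct.comm k A B (leftMul s b T) := by
  induction T using TensorProduct.induction_on with
  | zero => simp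
  | add x y hx hy => simp only [map_add, hx, hy]
  | tmul u v =>
    rw [comm_tmul, rightMul_tmul, flipConj_tmul, leftMul_tmul, map_mul, comm_tmul, mul_comm]

lemma IsTwistingMap.flipConj (h : IsTwistingMap s) : IsTwistingMap (flipConj s) := by
  rw [isTwistingMap_iff]
  refine ⟨fun b => ?_, fun a => ?_, fun a a' b => ?_, fun a b b' => ?_⟩
  · rw [flipConj_tmul, h.tmul_one, comm_tmul]
  · rw [flipConj_tmul, h.one_tmul, comm_tmul]
  · rw [flipConj_tmul, flipConj_tmul, leftMul_flipConj, ← h.map_tmul_mul, mul_comm]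
  · rw [flipConj_tmul, flipConj_tmul, rightMul_flipConj, ← h.map_mul_tmul, mul_comm]

lemma congr_tmul (f : A ≃ₐ[k] A) (g : B ≃ₐ[k] B) (a : A) (b : B) :
    congr f g (a ⊗ₜ[k] b) = f a ⊗ₜ[k] g b := rfl

/-- The twisting map `(f ⊗ g) ∘ s ∘ (g ⊗ f)⁻¹` obtained from `s` by transport along automorphisms
`f` of `A` and `g` of `B`. -/
def conj (f : A ≃ₐ[k] A) (g : B ≃ₐ[k] B) (s : B ⊗[k] A →ₗ[k] A ⊗[k] B) :
    B ⊗[k] A →ₗ[k] A ⊗[k] B :=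
  (congr f g).toLinearMap ∘ₗ s ∘ₗ (congr g.symm f.symm).toLinearMap

lemma conj_tmul (f : A ≃ₐ[k] A) (g : B ≃ₐ[k] B) (b : B) (a : A) :
    conj f g s (b ⊗ₜ a) = congr f g (s (g.symm b ⊗ₜ f.symm a)) := rfl

lemma leftMul_conj (f : A ≃ₐ[k] A) (g : B ≃ₐ[k] B) (b : B) (T : A ⊗[k] B) :
    leftMul (conj f g s) b (congr f g T) = congr f g (leftMul s (g.symm b) T) := by
  induction T using TensorProduct.induction_on with
  | zero => simp
  | add x y hx hy => simp only [map_add, hx, hy]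
  | tmul u v =>
    rw [congr_tmul, leftMul_tmul, conj_tmul, leftMul_tmul, map_mul, congr_tmul, map_one,
      f.symm_apply_apply]

lemma rightMul_conj (f : A ≃ₐ[k] A) (g : B ≃ₐ[k] B) (a : A) (T : A ⊗[k] B) :
    rightMul (conj f g s) a (congr f g T) = congr f g (rightMul s (f.symm a) T) := by
  induction T using TensorProduct.induction_on with
  | zero => simp
  | add x y hx hy => simp only [map_add, hx, hy]
  | tmul u v =>
    rw [congr_tmul, rightMul_tmul, conj_tmul, rightMul_tmul, map_mul, congr_tmul, map_one,
      g.symm_apply_apply]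

lemma IsTwistingMap.conj (h : IsTwistingMap s) (f : A ≃ₐ[k] A) (g : B ≃ₐ[k] B) :
    IsTwistingMap (conj f g s) := by
  rw [isTwistingMap_iff]
  refine ⟨fun a => ?_, fun b => ?_, fun b b' a => ?_, fun b a a' => ?_⟩
  · rw [conj_tmul, map_one, h.one_tmul]; simp
  · rw [conj_tmul, map_one, h.tmul_one]; simp
  · rw [conj_tmul, conj_tmul, leftMul_conj, ← h.map_mul_tmul, map_mul]
  · rw [conj_tmul, conj_tmul, rightMul_conj, ← h.map_tmul_mul, map_mul]

lemma isTwistMorphism_iff {f : A ≃ₐ[k] A} {g : B ≃ₐ[k] B} {t : B ⊗[k] A →ₗ[k] A ⊗[k] B} :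
    IsTwistMorphism (f : A →ₐ[k] A) (g : B →ₐ[k] B) s t ↔
      ∀ b a, t (g b ⊗ₜ f a) = congr f g (s (b ⊗ₜ a)) :=
  ⟨fun h b a => LinearMap.congr_fun h (b ⊗ₜ a), fun h => TensorProduct.ext' h⟩

lemma isTwistMorphism_conj (f : A ≃ₐ[k] A) (g : B ≃ₐ[k] B) :
    IsTwistMorphism (f : A →ₐ[k] A) (g : B →ₐ[k] B) s (conj f g s) := by
  rw [isTwistMorphism_iff]
  intro b a
  rw [conj_tmul, f.symm_apply_apply, g.symm_apply_apply]

lemma isTwistMorphism_conj_symm (f : A ≃ₐ[k] A) (g : B ≃ₐ[k] B) :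
    IsTwistMorphism (f : A →ₐ[k] A) (g : B →ₐ[k] B) (conj f.symm g.symm s) s := by
  rw [isTwistMorphism_iff]
  intro b a
  rw [conj_tmul, congr_symm, AlgEquiv.apply_symm_apply, f.symm_symm, g.symm_symm]

end Commutative

/-! ### The tensor product as the algebra of polynomials in two variables -/

variable {k : Type*} [CommRing k]

/-- The isomorphism of `k[X] ⊗ k[Y]` with `k[X][Y]`. -/
def toBivariate (k : Type*) [CommRing k] : k[X] ⊗[k] k[X] ≃ₐ[k] k[X][X] :=
  (polyEquivTensor k k[X]).symm

lemma toBivariate_tmul (a b : k[X]) : toBivariate k (a ⊗ₜ b) = C a * b.map C := by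
  rw [toBivariate, polyEquivTensor_symm_apply_tmul_eq_smul, smul_eq_C_mul]
  rfl

lemma coeff_toBivariate_tmul (a b : k[X]) (n : ℕ) :
    (toBivariate k (a ⊗ₜ b)).coeff n = a * C (b.coeff n) := by
  rw [toBivariate_tmul, coeff_C_mul, coeff_map]

lemma alphaMap_apply (s : k[X] ⊗[k] k[X] →ₗ[k] k[X] ⊗[k] k[X]) (n : ℕ) (a : k[X]) :
    alphaMap s n a = (toBivariate k (s (X ⊗ₜ a))).coeff n := by
  have : ∀ T : k[X] ⊗[k] k[X],
      TensorProduct.rid k k[X] ((lcoeff k n).lTensor k[X] T) = (toBivariate k T).coeff n := by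
    intro T
    induction T using TensorProduct.induction_on with
    | zero => simp
    | add x y hx hy => simp only [map_add, hx, hy, coeff_add]
    | tmul x y => simp [coeff_toBivariate_tmul, smul_eq_C_mul, mul_comm]
  exact this _

lemma isUpperBounded_iff {s : k[X] ⊗[k] k[X] →ₗ[k] k[X] ⊗[k] k[X]} :
    IsUpperBounded s ↔ ∃ N, ∀ a, (toBivariate k (s (X ⊗ₜ a))).natDegree ≤ N := by
  constructor
  · rintro ⟨N, hN⟩
    refine ⟨N, fun a => natDegree_le_iff_coeff_eq_zero.2 fun n hn => ?_⟩
    rw [← alphaMap_apply, hN n hn.le, LinearMap.zero_apply]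
  · rintro ⟨N, hN⟩
    refine ⟨N + 1, fun n hn => LinearMap.ext fun a => ?_⟩
    rw [alphaMap_apply, LinearMap.zero_apply]
    exact coeff_eq_zero_of_natDegree_lt ((hN a).trans_lt hn)

lemma shift_apply (a : k) (p : k[X]) : shift a p = p.comp (X - C a) := by
  rw [sub_eq_add_neg, ← C_neg]
  rfl

lemma shift_symm (a : k) : (shift a).symm = shift (-a) :=
  algEquivAevalXAddC_symm _

/-- Shifting the variables does not raise the degree in `Y`. -/
lemma natDegree_toBivariate_congr_le (f : k[X] ≃ₐ[k] k[X]) (a : k) (T : k[X] ⊗[k] k[X]) :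
    (toBivariate k (congr f (shift a) T)).natDegree ≤ (toBivariate k T).natDegree := by
  have : toBivariate k (congr f (shift a) T) =
      ((toBivariate k T).map (f : k[X] →+* k[X])).comp (X - C (C a)) := by
    induction T using TensorProduct.induction_on with
    | zero => simp
    | add x y hx hy => simp only [map_add, hx, hy, Polynomial.map_add, add_comp]
    | tmul x y =>
      have hf : (f : k[X] →+* k[X]).comp C = C := RingHom.ext fun c => f.commutes c
      rw [congr_tmul, toBivariate_tmul, toBivariate_tmul, shift_apply, Polynomial.map_mul, map_C,
        Polynomial.map_map, hf, mul_comp, C_comp, Polynomial.map_comp]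
      simp
  rw [this]
  refine natDegree_comp_le.trans ?_
  calc _ ≤ (toBivariate k T).natDegree * 1 :=
        Nat.mul_le_mul natDegree_map_le (natDegree_X_sub_C_le _)
    _ = _ := mul_one _

/-! ### The coefficients of `Y X` -/

lemma tensorOf_eq (q : ℕ × ℕ →₀ k) :
    tensorOf q = q.sum fun p c => c • ((X ^ p.1 : k[X]) ⊗ₜ[k] (X ^ p.2 : k[X])) := rfl

lemma tensorOf_add (p q : ℕ × ℕ →₀ k) : tensorOf (p + q) = tensorOf p + tensorOf q := by
  simp only [tensorOf_eq]
  exact Finsupp.sum_add_index' (by simp) (by simp [add_smul])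

lemma tensorOf_single (p : ℕ × ℕ) (c : k) :
    tensorOf (Finsupp.single p c) = c • ((X ^ p.1 : k[X]) ⊗ₜ[k] (X ^ p.2 : k[X])) := by
  rw [tensorOf_eq, Finsupp.sum_single_index (by simp)]

lemma tensorOf_surjective : Function.Surjective (tensorOf (k := k)) := by
  intro T
  induction T using TensorProduct.induction_on with
  | zero => exact ⟨0, by simp [tensorOf]⟩
  | add x y hx hy =>
    obtain ⟨p, rfl⟩ := hx
    obtain ⟨q, rfl⟩ := hy
    exact ⟨p + q, tensorOf_add p q⟩
  | tmul a b =>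
    induction a using Polynomial.induction_on' with
    | add x y hx hy =>
      obtain ⟨p, hp⟩ := hx
      obtain ⟨q, hq⟩ := hy
      exact ⟨p + q, by rw [tensorOf_add, hp, hq, TensorProduct.add_tmul]⟩
    | monomial i c =>
      induction b using Polynomial.induction_on' with
      | add x y hx hy =>
        obtain ⟨p, hp⟩ := hx
        obtain ⟨q, hq⟩ := hy
        exact ⟨p + q, by rw [tensorOf_add, hp, hq, TensorProduct.tmul_add]⟩
      | monomial j d =>
        refine ⟨Finsupp.single (i, j) (c * d), ?_⟩
        rw [tensorOf_single, ← smul_X_eq_monomial, ← smul_X_eq_monomial,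
          TensorProduct.smul_tmul_smul]

lemma colPoly_eq_sum (q : ℕ × ℕ →₀ k) (j : ℕ) :
    colPoly q j = q.sum fun p c => if p.2 = j then monomial p.1 c else 0 := by
  rw [colPoly, Finset.sum_filter]; rfl

lemma colPoly_coeff (q : ℕ × ℕ →₀ k) (i j : ℕ) : (colPoly q j).coeff i = q (i, j) := by
  rw [colPoly_eq_sum, Finsupp.sum, finsetSum_coeff, Finset.sum_eq_single (i, j)]
  · simp
  · rintro ⟨a, b⟩ - h
    by_cases hb : b = j
    · have : a ≠ i := fun ha => h (by rw [ha, hb])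
      simp [hb, coeff_monomial, this]
    · simp [hb]
  · intro h
    simpa using h

lemma coeff_toBivariate_tensorOf (q : ℕ × ℕ →₀ k) (j : ℕ) :
    (toBivariate k (tensorOf q)).coeff j = colPoly q j := by
  rw [colPoly_eq_sum, tensorOf_eq, Finsupp.sum, Finsupp.sum, map_sum, finsetSum_coeff]
  refine Finset.sum_congr rfl fun p _ => ?_
  rw [map_smul, coeff_smul, coeff_toBivariate_tmul, coeff_X_pow]
  simp only [eq_comm (a := j)]
  split_ifs <;> simp [smul_X_eq_monomial]

/-- The coefficients `q` with the roles of `X` and `Y` interchanged. -/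
def transpose (q : ℕ × ℕ →₀ k) : ℕ × ℕ →₀ k := q.mapDomain Prod.swap

lemma transpose_apply (q : ℕ × ℕ →₀ k) (i j : ℕ) : transpose q (i, j) = q (j, i) :=
  Finsupp.mapDomain_apply Prod.swap_injective q (j, i)

lemma tensorOf_transpose (q : ℕ × ℕ →₀ k) :
    tensorOf (transpose q) = Algebra.TensorProduct.comm k k[X] k[X] (tensorOf q) := by
  rw [tensorOf_eq, tensorOf_eq, transpose, Finsupp.sum_mapDomain_index (by simp)
    (by simp [add_smul]), Finsupp.sum, Finsupp.sum, map_sum]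
  simp

lemma rowPoly_eq_colPoly (q : ℕ × ℕ →₀ k) (i : ℕ) : rowPoly q i = colPoly (transpose q) i := by
  ext n
  rw [colPoly_coeff, transpose_apply, rowPoly, Finset.sum_filter, finsetSum_coeff,
    Finset.sum_eq_single (i, n)]
  · simp
  · rintro ⟨a, b⟩ - h
    by_cases hb : a = i
    · have : b ≠ n := fun ha => h (by rw [ha, hb])
      simp [hb, coeff_monomial, this]
    · simp [hb]
  · intro h
    simpa using h

lemma transpose_transpose (q : ℕ × ℕ →₀ k) : transpose (transpose q) = q := by
  ext ⟨i, j⟩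
  rw [transpose_apply, transpose_apply]

lemma condA_iff_condB_transpose {q : ℕ × ℕ →₀ k} {lam ξ : k} :
    CondA q lam ξ ↔ CondB (transpose q) ξ lam := by
  simp only [CondA, CondB, rowPoly_eq_colPoly]

lemma condB_iff_condA_transpose {q : ℕ × ℕ →₀ k} {lam ξ : k} :
    CondB q lam ξ ↔ CondA (transpose q) ξ lam := by
  rw [condA_iff_condB_transpose, transpose_transpose]

lemma isMultipleRoot_iff {p : k[X]} {a : k} :
    IsMultipleRoot p a ↔ p.eval a = 0 ∧ p.derivative.eval a = 0 := by
  rw [IsMultipleRoot, X_sub_C_pow_dvd_iff, X_pow_dvd_iff]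
  have h0 : (p.comp (X + C a)).coeff 0 = p.eval a := by simp [coeff_zero_eq_eval_zero]
  have h1 : (p.comp (X + C a)).coeff 1 = p.derivative.eval a := by
    rw [← taylor_apply, taylor_coeff_one]
  rw [← h0, ← h1]
  exact ⟨fun h => ⟨h 0 two_pos, h 1 one_lt_two⟩, fun h d hd => by interval_cases d <;> simp [h]⟩

/-- The element `T - lam Y - ξ X + lam ξ` of `k[X] ⊗ k[Y]`. With `T = Y X` it is the product
`(Y - ξ) (X - lam)`, reordered by the twisting map. -/
def recenter (lam ξ : k) (T : k[X] ⊗[k] k[X]) : k[X] ⊗[k] k[X] :=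
  T - lam • (1 ⊗ₜ X) - ξ • (X ⊗ₜ 1) + (lam * ξ) • 1

lemma comm_recenter (lam ξ : k) (T : k[X] ⊗[k] k[X]) :
    Algebra.TensorProduct.comm k k[X] k[X] (recenter lam ξ T) =
      recenter ξ lam (Algebra.TensorProduct.comm k k[X] k[X] T) := by
  simp only [recenter, map_add, map_sub, map_smul, map_one, comm_tmul, mul_comm lam]
  abel

/-- Divisibility of an element of `k[X] ⊗ k[Y]` by a polynomial in `X` is divisibility of the
coefficients of the powers of `Y`. -/
lemma tmul_one_dvd_iff {p : k[X]} {T : k[X] ⊗[k] k[X]} :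
    p ⊗ₜ[k] (1 : k[X]) ∣ T ↔ ∀ j, p ∣ (toBivariate k T).coeff j := by
  rw [← map_dvd_iff (toBivariate k), toBivariate_tmul, Polynomial.map_one, mul_one,
    C_dvd_iff_dvd_coeff]

lemma condB_iff_dvd {q : ℕ × ℕ →₀ k} {lam ξ : k} :
    CondB q lam ξ ↔ ((X - C lam) ^ 2) ⊗ₜ[k] (1 : k[X]) ∣ recenter lam ξ (tensorOf q) := by
  have hc : ∀ j, (toBivariate k (recenter lam ξ (tensorOf q))).coeff j =
      colPoly q j - lam • C ((X : k[X]).coeff j) - ξ • (X * C ((1 : k[X]).coeff j)) +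
        (lam * ξ) • C ((1 : k[X]).coeff j) := by
    intro j
    simp only [recenter, map_add, map_sub, map_smul, one_def, coeff_add, coeff_sub, coeff_smul,
      coeff_toBivariate_tmul, coeff_toBivariate_tensorOf, one_mul]
  have h0 : IsMultipleRoot ((toBivariate k (recenter lam ξ (tensorOf q))).coeff 0) lam ↔
      (colPoly q 0).eval lam = 0 ∧ (colPoly q 0).derivative.eval lam = ξ := by
    rw [hc, isMultipleRoot_iff]
    simp [smul_eq_C_mul, mul_comm ξ, sub_eq_zero]
  have h1 : IsMultipleRoot ((toBivariate k (recenter lam ξ (tensorOf q))).coeff 1) lam ↔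
      (colPoly q 1).eval lam = lam ∧ (colPoly q 1).derivative.eval lam = 0 := by
    rw [hc, isMultipleRoot_iff]
    simp [smul_eq_C_mul, coeff_one, sub_eq_zero]
  have h2 : ∀ j > 1, (toBivariate k (recenter lam ξ (tensorOf q))).coeff j = colPoly q j := by
    intro j hj
    rw [hc, coeff_X, coeff_one, if_neg (by omega), if_neg (by omega)]
    simp
  rw [tmul_one_dvd_iff]
  constructor
  · rintro ⟨a1, a2, a3, a4, a5⟩ j
    rcases j with _ | _ | j
    · exact h0.2 ⟨a1, a3⟩
    · exact h1.2 ⟨a2, a4⟩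
    · rw [h2 _ (by omega)]
      exact a5 _ (by omega)
  · intro h
    obtain ⟨a1, a3⟩ := h0.1 (h 0)
    obtain ⟨a2, a4⟩ := h1.1 (h 1)
    refine ⟨a1, a2, a3, a4, fun j hj => ?_⟩
    rw [← h2 j hj]
    exact h j

lemma condA_iff_dvd {q : ℕ × ℕ →₀ k} {lam ξ : k} :
    CondA q lam ξ ↔ (1 : k[X]) ⊗ₜ[k] ((X - C ξ) ^ 2) ∣ recenter lam ξ (tensorOf q) := by
  rw [condA_iff_condB_transpose, condB_iff_dvd, tensorOf_transpose, ← comm_recenter,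
    ← comm_tmul k, map_dvd_iff]

lemma condA_zero_iff {q : ℕ × ℕ →₀ k} :
    CondA q 0 0 ↔ (1 : k[X]) ⊗ₜ[k] (X ^ 2) ∣ tensorOf q := by
  simp [condA_iff_dvd, recenter]

lemma condB_zero_iff {q : ℕ × ℕ →₀ k} :
    CondB q 0 0 ↔ (X ^ 2) ⊗ₜ[k] (1 : k[X]) ∣ tensorOf q := by
  simp [condB_iff_dvd, recenter]

lemma condB_zero_iff_coeff {q : ℕ × ℕ →₀ k} :
    CondB q 0 0 ↔ ∀ i j, i ≤ 1 → q (i, j) = 0 := by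
  rw [condB_zero_iff, tmul_one_dvd_iff]
  simp only [coeff_toBivariate_tensorOf, X_pow_dvd_iff, colPoly_coeff]
  exact ⟨fun h i j hi => h j i (by omega), fun h j i hi => h i j (by omega)⟩

lemma condA_zero_iff_coeff {q : ℕ × ℕ →₀ k} :
    CondA q 0 0 ↔ ∀ i j, j ≤ 1 → q (i, j) = 0 := by
  rw [condA_iff_condB_transpose, condB_zero_iff_coeff]
  simp only [transpose_apply]
  exact forall_comm

/-! ### Upper bounded twisting maps with `Y X` divisible by `Y ^ 2` -/

section Bounded

variable {k : Type*} [CommRing k] {s : k[X] ⊗[k] k[X] →ₗ[k] k[X] ⊗[k] k[X]}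

lemma IsTwistingMap.isMulPair (h : IsTwistingMap s) :
    IsMulPair ((toBivariate k).toLinearMap ∘ₗ leftMul s X ∘ₗ (toBivariate k).symm.toLinearMap)
      ((toBivariate k).toLinearMap ∘ₗ rightMul s X ∘ₗ (toBivariate k).symm.toLinearMap) := by
  have hX : ∀ i, (toBivariate k).symm (X ^ i) = 1 ⊗ₜ (X ^ i) := fun i => by
    rw [AlgEquiv.symm_apply_eq, toBivariate_tmul]; simp
  have hC : ∀ a, (toBivariate k).symm (C a) = a ⊗ₜ 1 := fun a => by
    rw [AlgEquiv.symm_apply_eq, toBivariate_tmul]; simp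
  have hX' : toBivariate k (1 ⊗ₜ X) = X := by rw [toBivariate_tmul]; simp
  have hC' : ∀ a, toBivariate k (a ⊗ₜ 1) = C a := fun a => by rw [toBivariate_tmul]; simp
  constructor
  · intro w
    simp only [LinearMap.comp_apply, AlgEquiv.toLinearMap_apply, map_mul]
    rw [← pow_one (X : k[X][X]), hX, mul_comm, leftMul_mul_tmul, map_mul, pow_one, hX', pow_one,
      mul_comm]
  · intro a w
    simp only [LinearMap.comp_apply, AlgEquiv.toLinearMap_apply, map_mul]
    rw [hC, rightMul_tmul_mul, map_mul, hC']
  · simp only [LinearMap.comp_apply, AlgEquiv.toLinearMap_apply]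
    rw [map_one, one_def, leftMul_tmul, ← one_def, mul_one, h.tmul_one, hX']
  · simp only [LinearMap.comp_apply, AlgEquiv.toLinearMap_apply]
    rw [map_one, one_def, rightMul_tmul, ← one_def, one_mul, h.one_tmul, hC']
  · intro i
    simp only [LinearMap.comp_apply, AlgEquiv.toLinearMap_apply, AlgEquiv.symm_apply_apply]
    rw [hX, hX, rightMul_tmul, rightMul_tmul, ← one_def, one_mul, one_mul, ← h.map_mul_tmul,
      pow_succ']
  · intro i
    simp only [LinearMap.comp_apply, AlgEquiv.toLinearMap_apply, AlgEquiv.symm_apply_apply]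
    rw [hC, hC, leftMul_tmul, leftMul_tmul, ← one_def, mul_one, mul_one, ← h.map_tmul_mul,
      pow_succ]

theorem IsTwistingMap.condB_zero [IsDomain k] (h : IsTwistingMap s) (hb : IsUpperBounded s)
    {q : ℕ × ℕ →₀ k} (hq : s (X ⊗ₜ X) = tensorOf q) (hA : CondA q 0 0) : CondB q 0 0 := by
  obtain ⟨N, hN⟩ := isUpperBounded_iff.1 hb
  have hC : ∀ a, (toBivariate k).symm (C a) = a ⊗ₜ 1 := fun a => by
    rw [AlgEquiv.symm_apply_eq, toBivariate_tmul]; simp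
  have hL : ∀ a, ((toBivariate k).toLinearMap ∘ₗ leftMul s X ∘ₗ
      (toBivariate k).symm.toLinearMap) (C a) = toBivariate k (s (X ⊗ₜ a)) := by
    intro a
    simp only [LinearMap.comp_apply, AlgEquiv.toLinearMap_apply]
    rw [hC, leftMul_tmul, ← one_def, mul_one]
  rw [condA_zero_iff, ← map_dvd_iff (toBivariate k), toBivariate_tmul] at hA
  rw [condB_zero_iff, ← map_dvd_iff (toBivariate k), toBivariate_tmul]
  have := h.isMulPair.C_X_sq_dvd_left_C_X (N := N)
    (by rw [hL, hq]; simpa using hA) (fun a => by rw [hL]; exact hN a)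
  rw [hL, hq] at this
  simpa using this

end Bounded

/-! ### Null twisting maps -/

section Null

variable {k : Type*} [CommRing k]

/-- The linear map with `s (1 ⊗ a) = a ⊗ 1`, `s (b ⊗ 1) = 1 ⊗ b`, `s (Y ⊗ X) = T`, and
`s (Y ^ i ⊗ X ^ j) = 0` for all other positive `i` and `j`. -/
def nullMap (T : k[X] ⊗[k] k[X]) : k[X] ⊗[k] k[X] →ₗ[k] k[X] ⊗[k] k[X] :=
  TensorProduct.lift (LinearMap.mk₂ k (fun b a => b.coeff 0 • (a ⊗ₜ 1) + a.coeff 0 • (1 ⊗ₜ b) -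
      (a.coeff 0 * b.coeff 0) • 1 + (b.coeff 1 * a.coeff 1) • T)
    (fun b b' a => by
      simp only [coeff_add, TensorProduct.tmul_add, add_smul, smul_add, mul_add, add_mul]; abel)
    (fun c b a => by
      simp only [coeff_smul, TensorProduct.tmul_smul, smul_eq_mul]; module)
    (fun b a a' => by
      simp only [coeff_add, TensorProduct.add_tmul, add_smul, smul_add, mul_add, add_mul]; abel)
    (fun c b a => by
      simp only [coeff_smul, ← TensorProduct.smul_tmul', smul_eq_mul]; module))

variable {T : k[X] ⊗[k] k[X]}

lemma nullMap_tmul (b a : k[X]) :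
    nullMap T (b ⊗ₜ a) = b.coeff 0 • (a ⊗ₜ 1) + a.coeff 0 • (1 ⊗ₜ b) -
      (a.coeff 0 * b.coeff 0) • 1 + (b.coeff 1 * a.coeff 1) • T := rfl

lemma leftMul_nullMap (b : k[X]) {W : k[X] ⊗[k] k[X]} (hW : (X ^ 2) ⊗ₜ[k] (1 : k[X]) ∣ W) :
    leftMul (nullMap T) b W = b.coeff 0 • W := by
  obtain ⟨V, rfl⟩ := hW
  induction V using TensorProduct.induction_on with
  | zero => simp
  | add x y hx hy => rw [mul_add, map_add, hx, hy, smul_add]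
  | tmul u v =>
    rw [tmul_mul_tmul, one_mul, leftMul_tmul, nullMap_tmul]
    simp [coeff_X_pow_mul']

lemma rightMul_nullMap (a : k[X]) {W : k[X] ⊗[k] k[X]} (hW : (1 : k[X]) ⊗ₜ[k] (X ^ 2) ∣ W) :
    rightMul (nullMap T) a W = a.coeff 0 • W := by
  obtain ⟨V, rfl⟩ := hW
  induction V using TensorProduct.induction_on with
  | zero => simp
  | add x y hx hy => rw [mul_add, map_add, hx, hy, smul_add]
  | tmul u v =>
    rw [tmul_mul_tmul, one_mul, rightMul_tmul, nullMap_tmul]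
    simp [coeff_X_pow_mul']

lemma nullMap_X_tmul_X : nullMap T (X ⊗ₜ X) = T := by
  simp [nullMap_tmul]

lemma isTwistingMap_nullMap (h₁ : (X ^ 2) ⊗ₜ[k] (1 : k[X]) ∣ T)
    (h₂ : (1 : k[X]) ⊗ₜ[k] (X ^ 2) ∣ T) : IsTwistingMap (nullMap T) := by
  have e₁ : T * (1 ⊗ₜ 1) = T := mul_one T
  have e₂ : (1 ⊗ₜ 1) * T = T := one_mul T
  rw [isTwistingMap_iff]
  refine ⟨fun a => ?_, fun b => ?_, fun b b' a => ?_, fun b a a' => ?_⟩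
  · rw [nullMap_tmul]
    simp [coeff_one, one_def]
  · rw [nullMap_tmul]
    simp [coeff_one, one_def]
  · rw [nullMap_tmul b' a, map_add, map_sub, map_add, map_smul, map_smul, map_smul, map_smul,
      leftMul_nullMap b h₁, one_def, leftMul_tmul, leftMul_tmul, leftMul_tmul, nullMap_tmul,
      nullMap_tmul, nullMap_tmul]
    simp only [mul_coeff_zero, mul_coeff_one, coeff_one, one_def, tmul_mul_tmul, smul_mul_assoc,
      sub_mul, add_mul, mul_one, one_mul, e₁]
    simp only [if_true, one_ne_zero, if_false, mul_zero, zero_smul, add_zero, one_smul]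
    module
  · rw [nullMap_tmul b a, map_add, map_sub, map_add, map_smul, map_smul, map_smul, map_smul,
      rightMul_nullMap a' h₂, one_def, rightMul_tmul, rightMul_tmul, rightMul_tmul, nullMap_tmul,
      nullMap_tmul, nullMap_tmul]
    simp only [mul_coeff_zero, mul_coeff_one, coeff_one, one_def, tmul_mul_tmul, mul_smul_comm,
      mul_sub, mul_add, mul_one, one_mul, e₂]
    simp only [if_true, one_ne_zero, if_false, zero_smul, add_zero, one_smul, zero_mul]
    module

lemma isNullTwistingMap_iff {s : k[X] ⊗[k] k[X] →ₗ[k] k[X] ⊗[k] k[X]} :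
    IsNullTwistingMap s ↔ IsTwistingMap s ∧
      ∃ q, s (X ⊗ₜ X) = tensorOf q ∧ CondA q 0 0 ∧ CondB q 0 0 := by
  simp only [IsNullTwistingMap, condA_zero_iff_coeff, condB_zero_iff_coeff]
  refine and_congr_right fun _ => exists_congr fun q => ?_
  exact ⟨fun ⟨h, h'⟩ => ⟨h', fun i j hj => h i j (.inr hj), fun i j hi => h i j (.inl hi)⟩,
    fun ⟨h', h₁, h₂⟩ => ⟨fun i j h => h.elim (h₂ i j) (h₁ i j), h'⟩⟩

end Null

/-! ### Affine changes of variables -/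

section Affine

variable {k : Type*} [CommRing k] {s t : k[X] ⊗[k] k[X] →ₗ[k] k[X] ⊗[k] k[X]}

lemma IsTwistingMap.smul_recenter_eq (ht : IsTwistingMap t) {f g : k[X] ≃ₐ[k] k[X]}
    (h : IsTwistMorphism (f : k[X] →ₐ[k] k[X]) (g : k[X] →ₐ[k] k[X]) s t) {u v lam ξ : k}
    (hf : f X = u • (X - C lam)) (hg : g X = v • (X - C ξ)) :
    (v * u) • recenter lam ξ (t (X ⊗ₜ X)) = congr f g (s (X ⊗ₜ X)) := by
  have hC : ∀ c : k, (C c : k[X]) = c • 1 := fun c => by rw [smul_eq_C_mul, mul_one]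
  rw [← isTwistMorphism_iff.1 h, hf, hg, TensorProduct.smul_tmul_smul, map_smul,
    TensorProduct.tmul_sub, TensorProduct.sub_tmul, TensorProduct.sub_tmul, hC, hC,
    TensorProduct.tmul_smul, TensorProduct.tmul_smul]
  simp only [← TensorProduct.smul_tmul', map_sub, map_smul, ht.one_tmul, ht.tmul_one, recenter,
    one_def]
  module

/-- An affine change of variables moves the double roots of the rows and columns to the origin. -/
lemma IsTwistingMap.cond_iff (ht : IsTwistingMap t) {f g : k[X] ≃ₐ[k] k[X]}
    (h : IsTwistMorphism (f : k[X] →ₐ[k] k[X]) (g : k[X] →ₐ[k] k[X]) s t) {u v lam ξ : k}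
    (hu : IsUnit u) (hv : IsUnit v)
    (hf : f X = u • (X - C lam)) (hg : g X = v • (X - C ξ)) {q q' : ℕ × ℕ →₀ k}
    (hq : s (X ⊗ₜ X) = tensorOf q) (hq' : t (X ⊗ₜ X) = tensorOf q') :
    (CondA q' lam ξ ↔ CondA q 0 0) ∧ (CondB q' lam ξ ↔ CondB q 0 0) := by
  have key := ht.smul_recenter_eq h hf hg
  rw [hq, hq'] at key
  have unit : ∀ {c : k}, IsUnit c → ∀ {W V : k[X] ⊗[k] k[X]}, (W ∣ c • V ↔ W ∣ V) ∧
      (c • W ∣ V ↔ W ∣ V) := by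
    intro c hc W V
    obtain ⟨d, hd⟩ := hc.exists_right_inv
    have hc' : IsUnit (c • (1 : k[X] ⊗[k] k[X])) :=
      .of_mul_eq_one (d • 1) (by rw [smul_mul_smul_comm, hd, mul_one, one_smul])
    rw [← smul_one_mul c V, ← smul_one_mul c W]
    exact ⟨hc'.dvd_mul_left, hc'.mul_left_dvd⟩
  constructor
  · rw [condA_iff_dvd, condA_zero_iff, ← map_dvd_iff (congr f g) (b := tensorOf q),
      ← key, (unit (hv.mul hu)).1,
      congr_tmul, map_one, map_pow, hg, _root_.smul_pow, TensorProduct.tmul_smul, (unit (hv.pow 2)).2]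
  · rw [condB_iff_dvd, condB_zero_iff, ← map_dvd_iff (congr f g) (b := tensorOf q),
      ← key, (unit (hv.mul hu)).1,
      congr_tmul, map_one, map_pow, hf, _root_.smul_pow, ← TensorProduct.smul_tmul',
      (unit (hu.pow 2)).2]

lemma IsTwistingMap.cond_iff_of_shift (ht : IsTwistingMap t) {lam ξ : k}
    (h : IsTwistMorphism (shift lam : k[X] →ₐ[k] k[X]) (shift ξ : k[X] →ₐ[k] k[X]) s t)
    {q q' : ℕ × ℕ →₀ k} (hq : s (X ⊗ₜ X) = tensorOf q) (hq' : t (X ⊗ₜ X) = tensorOf q') :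
    (CondA q' lam ξ ↔ CondA q 0 0) ∧ (CondB q' lam ξ ↔ CondB q 0 0) :=
  ht.cond_iff h isUnit_one isUnit_one (by rw [shift_X, one_smul]) (by rw [shift_X, one_smul]) hq hq'

lemma IsUpperBounded.conj_shift (ht : IsTwistingMap t) (hb : IsUpperBounded t) (f : k[X] ≃ₐ[k] k[X])
    (a : k) : IsUpperBounded (conj f (shift a) t) := by
  obtain ⟨N, hN⟩ := isUpperBounded_iff.1 hb
  refine isUpperBounded_iff.2 ⟨N, fun p => ?_⟩
  have hC : (C (-a) : k[X]) = (-a) • 1 := by rw [smul_eq_C_mul, mul_one]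
  rw [conj_tmul, shift_symm, shift_X, hC, TensorProduct.sub_tmul, ← TensorProduct.smul_tmul',
    map_sub, map_smul, ht.one_tmul]
  refine (natDegree_toBivariate_congr_le _ _ _).trans ?_
  rw [map_sub, map_smul, toBivariate_tmul _ 1, Polynomial.map_one, mul_one, smul_C]
  exact (natDegree_sub_C).trans_le (hN _)

/-- An automorphism of the algebra of polynomials over a domain is an affine change of the
variable. -/
lemma exists_algEquiv_X_eq [IsDomain k] (f : k[X] ≃ₐ[k] k[X]) :
    ∃ u lam : k, IsUnit u ∧ f X = u • (X - C lam) := by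
  have hcomp : (f.symm X).comp (f X) = X := by
    rw [comp_eq_aeval, ← AlgEquiv.coe_toAlgHom, aeval_algHom_apply]
    simp
  have hdeg : (f.symm X).natDegree * (f X).natDegree = 1 := by
    rw [← natDegree_comp, hcomp, natDegree_X]
  have hd : (f X).natDegree = 1 := Nat.eq_one_of_mul_eq_one_left hdeg
  have hlead : (f.symm X).leadingCoeff * (f X).leadingCoeff = 1 := by
    have := leadingCoeff_comp (p := f.symm X) (q := f X) (by rw [hd]; exact one_ne_zero)
    rw [hcomp, leadingCoeff_X, Nat.eq_one_of_mul_eq_one_right hdeg, pow_one] at this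
    exact this.symm
  have hu : IsUnit (f X).leadingCoeff := IsUnit.of_mul_eq_one_right _ hlead
  refine ⟨(f X).leadingCoeff, -((f.symm X).leadingCoeff * (f X).coeff 0), hu, ?_⟩
  conv_lhs => rw [eq_X_add_C_of_natDegree_le_one hd.le]
  rw [smul_eq_C_mul, mul_sub, ← C_mul, mul_neg, ← mul_assoc, mul_comm (f X).leadingCoeff, hlead,
    one_mul, C_neg, sub_neg_eq_add, leadingCoeff, hd]

end Affine

/-! ### Twisting maps satisfying the root conditions -/

section Main

variable {k : Type*} [CommRing k] {q' : ℕ × ℕ →₀ k}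

lemma IsAlmostNull.exists_cond [IsDomain k] {s' : k[X] ⊗[k] k[X] →ₗ[k] k[X] ⊗[k] k[X]}
    (h : IsAlmostNull s') (hq' : s' (X ⊗ₜ X) = tensorOf q') :
    ∃ lam ξ : k, CondA q' lam ξ ∧ CondB q' lam ξ := by
  obtain ⟨hs', s, hs, f, g, hfg⟩ := h
  obtain ⟨-, q, hq, hA, hB⟩ := isNullTwistingMap_iff.1 hs
  obtain ⟨u, lam, hu, hf⟩ := exists_algEquiv_X_eq f
  obtain ⟨v, ξ, hv, hg⟩ := exists_algEquiv_X_eq g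
  have := hs'.cond_iff hfg hu hv hf hg hq hq'
  exact ⟨lam, ξ, this.1.2 hA, this.2.2 hB⟩

lemma exists_isNullTwistingMap {lam ξ : k} (hA : CondA q' lam ξ) (hB : CondB q' lam ξ)
    {s' : k[X] ⊗[k] k[X] →ₗ[k] k[X] ⊗[k] k[X]} (h : IsTwistingMap s')
    (hq' : s' (X ⊗ₜ X) = tensorOf q') :
    ∃ s : k[X] ⊗[k] k[X] →ₗ[k] k[X] ⊗[k] k[X], IsNullTwistingMap s ∧
      IsTwistMorphism (shift lam : k[X] →ₐ[k] k[X]) (shift ξ : k[X] →ₐ[k] k[X]) s s' := by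
  have hm := isTwistMorphism_conj_symm (s := s') (shift lam) (shift ξ)
  obtain ⟨q, hq⟩ := tensorOf_surjective (conj (shift lam).symm (shift ξ).symm s' (X ⊗ₜ X))
  have hc := h.cond_iff_of_shift hm hq.symm hq'
  exact ⟨_, isNullTwistingMap_iff.2 ⟨h.conj _ _, q, hq.symm, hc.1.1 hA, hc.2.1 hB⟩, hm⟩

lemma exists_isAlmostNull {lam ξ : k} (hA : CondA q' lam ξ) (hB : CondB q' lam ξ) :
    ∃ s' : k[X] ⊗[k] k[X] →ₗ[k] k[X] ⊗[k] k[X],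
      IsAlmostNull s' ∧ s' (X ⊗ₜ X) = tensorOf q' := by
  set T := (congr (shift lam) (shift ξ)).symm (recenter lam ξ (tensorOf q')) with hT
  have h₁ : (X ^ 2) ⊗ₜ[k] (1 : k[X]) ∣ T := by
    rw [← map_dvd_iff (congr (shift lam) (shift ξ)), hT, AlgEquiv.apply_symm_apply, congr_tmul,
      map_pow, shift_X, map_one]
    exact condB_iff_dvd.1 hB
  have h₂ : (1 : k[X]) ⊗ₜ[k] (X ^ 2) ∣ T := by
    rw [← map_dvd_iff (congr (shift lam) (shift ξ)), hT, AlgEquiv.apply_symm_apply, congr_tmul,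
      map_pow, shift_X, map_one]
    exact condA_iff_dvd.1 hA
  have hs := isTwistingMap_nullMap h₁ h₂
  obtain ⟨q, hq⟩ := tensorOf_surjective T
  have hm := isTwistMorphism_conj (s := nullMap T) (shift lam) (shift ξ)
  have ht := hs.conj (shift lam) (shift ξ)
  refine ⟨_, ⟨ht, nullMap T, isNullTwistingMap_iff.2 ⟨hs, q, ?_, ?_, ?_⟩, _, _, hm⟩, ?_⟩
  · rw [nullMap_X_tmul_X, hq]
  · rwa [condA_zero_iff, hq]
  · rwa [condB_zero_iff, hq]
  · have := ht.smul_recenter_eq (u := 1) (v := 1) (lam := lam) (ξ := ξ) hm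
      (by rw [shift_X, one_smul]) (by rw [shift_X, one_smul])
    rw [mul_one, one_smul, nullMap_X_tmul_X, hT, AlgEquiv.apply_symm_apply, ← hT] at this
    exact sub_left_inj.1 (sub_left_inj.1 (add_left_inj _ |>.1 this))

lemma IsTwistingMap.condB [IsDomain k] {s' : k[X] ⊗[k] k[X] →ₗ[k] k[X] ⊗[k] k[X]}
    (h : IsTwistingMap s') (hb : IsUpperBounded s') (hq' : s' (X ⊗ₜ X) = tensorOf q') {lam ξ : k}
    (hA : CondA q' lam ξ) : CondB q' lam ξ := by
  have hm := isTwistMorphism_conj_symm (s := s') (shift lam) (shift ξ)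
  obtain ⟨q, hq⟩ := tensorOf_surjective
    (TwistedPlane.conj (shift lam).symm (shift ξ).symm s' (X ⊗ₜ X))
  have hc := h.cond_iff_of_shift hm hq.symm hq'
  have hb' : IsUpperBounded (TwistedPlane.conj (shift lam).symm (shift ξ).symm s') := by
    rw [shift_symm ξ]
    exact hb.conj_shift h _ _
  exact hc.2.2 ((h.conj _ _).condB_zero hb' hq.symm (hc.1.1 hA))

lemma IsTwistingMap.condA [IsDomain k] {s' : k[X] ⊗[k] k[X] →ₗ[k] k[X] ⊗[k] k[X]}
    (h : IsTwistingMap s') (hb : IsLowerBounded s') (hq' : s' (X ⊗ₜ X) = tensorOf q') {lam ξ : k}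
    (hB : CondB q' lam ξ) : CondA q' lam ξ := by
  rw [condA_iff_condB_transpose]
  refine h.flipConj.condB hb ?_ (condB_iff_condA_transpose.1 hB)
  rw [flipConj_tmul, hq', tensorOf_transpose]

end Main

end TwistedPlane

end

theorem corollary3p5 {k : Type*} [CommRing k] [IsDomain k] (q' : ℕ × ℕ →₀ k) :
    ((∃ s' : k[X] ⊗[k] k[X] →ₗ[k] k[X] ⊗[k] k[X],
        TwistedPlane.IsAlmostNull s' ∧
          s' (Polynomial.X ⊗ₜ[k] Polynomial.X) = TwistedPlane.tensorOf q') ↔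
      ∃ lam ξ : k, TwistedPlane.CondA q' lam ξ ∧ TwistedPlane.CondB q' lam ξ) ∧
    (∀ lam ξ : k, TwistedPlane.CondA q' lam ξ → TwistedPlane.CondB q' lam ξ →
      ∀ s' : k[X] ⊗[k] k[X] →ₗ[k] k[X] ⊗[k] k[X], TwistedPlane.IsTwistingMap s' →
        s' (Polynomial.X ⊗ₜ[k] Polynomial.X) = TwistedPlane.tensorOf q' →
        ∃ s : k[X] ⊗[k] k[X] →ₗ[k] k[X] ⊗[k] k[X], TwistedPlane.IsNullTwistingMap s ∧
          TwistedPlane.IsTwistMorphism (TwistedPlane.shift lam : k[X] →ₐ[k] k[X])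
            (TwistedPlane.shift ξ : k[X] →ₐ[k] k[X]) s s') ∧
    ((∃ lam ξ : k, TwistedPlane.CondA q' lam ξ ∧ ¬ TwistedPlane.CondB q' lam ξ) →
      ¬ ∃ s' : k[X] ⊗[k] k[X] →ₗ[k] k[X] ⊗[k] k[X],
        TwistedPlane.IsTwistingMap s' ∧ TwistedPlane.IsUpperBounded s' ∧
          s' (Polynomial.X ⊗ₜ[k] Polynomial.X) = TwistedPlane.tensorOf q') ∧
    ((∃ lam ξ : k, TwistedPlane.CondB q' lam ξ ∧ ¬ TwistedPlane.CondA q' lam ξ) →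
      ¬ ∃ s' : k[X] ⊗[k] k[X] →ₗ[k] k[X] ⊗[k] k[X],
        TwistedPlane.IsTwistingMap s' ∧ TwistedPlane.IsLowerBounded s' ∧
          s' (Polynomial.X ⊗ₜ[k] Polynomial.X) = TwistedPlane.tensorOf q') := by
  refine ⟨⟨fun ⟨s', h, hq'⟩ => h.exists_cond hq', fun ⟨lam, ξ, hA, hB⟩ =>
      TwistedPlane.exists_isAlmostNull hA hB⟩,
    fun lam ξ hA hB s' h hq' => TwistedPlane.exists_isNullTwistingMap hA hB h hq', ?_, ?_⟩
  · rintro ⟨lam, ξ, hA, hB⟩ ⟨s', h, hb, hq'⟩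
    exact hB (h.condB hb hq' hA)
  · rintro ⟨lam, ξ, hB, hA⟩ ⟨s', h, hb, hq'⟩
    exact hA (h.condA hb hq' hB)
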